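/- Let $\mathcal X$ be a finite alphabet, $p$ a probability mass function on $\mathcal X$, and $d:\mathcal X\times\mathcal X\to[0,d_{\max}]$ a distortion measure. Let $X_1,X_2,\dots$ be a memoryless source, i.e. i.i.d. with law $p$. For $D\in\mathbb R$ the information (feedforward) rate-distortion function is Shannon's $$R_I(D)=\inf\{\,I(\hat X;X)\;:\;p_{\hat X|X}\text{ a channel from }\mathcal X\text{ to }\mathcal X\text{ with }\mathbb E[d(X,\hat X)]\le D\,\},$$ where $X\sim p$, mutual information is measured in bits, and $\inf\emptyset=+\infty$. A feedforward code of block length $n$ and rate $R\in\mathbb R$ consists of an encoder $f_n:\mathcal X^n\to\{m\in\mathbb Z:1\le m\le 2^{nR}\}$ and decoder maps $g_{n,i}$, $1\le i\le n$, that produce the reconstruction $\hat X_i=g_{n,i}\big(f_n(X_1,\dots,X_n),X_1,\dots,X_{i-1}\big)\in\mathcal X$ from the message and the source samples strictly before time $i$ (perfect side information with unit lag). A rate $R$ is achievable at distortion $D$ if there is a sequence of such codes of rate $R$, $n\to\infty$, with $$\limsup_{n\to\infty}\ \mathbb E\Big[\frac1n\sum_{i=1}^n d(X_i,\hat X_i)\Big]\le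 D .$$ The operational feedforward rate-distortion function $R_O(D)$ is the infimum of the rates achievable at distortion $D$ (with $\inf\emptyset=+\infty$). Proposition. For every $D\in\mathbb R$, $$R_O(D)=R_I(D),$$ and, whenever some rate is achievable at distortion $D$, the infimum defining $R_O(D)$ is attained, so that $R_O(D)$ is the minimum rate achievable at distortion $D$. -/

import Mathlib

noncomputable section

namespace Feedforward

variable {X : Type*} [Fintype X]

/-- Mutual information, in bits, of a pair of random variables with joint probability mass
function `J` on the finite set `X × X`:
`∑ J(x,y) log₂ (J(x,y) / (J_1(x) J_2(y)))`, where `J_1`, `J_2` are the two marginals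
(terms with `J(x,y) = 0` vanish). -/
def mutualInfo (J : X → X → ℝ) : ℝ :=
  ∑ x, ∑ y, J x y * Real.logb 2 (J x y / ((∑ y', J x y') * (∑ x', J x' y)))

/-- A channel (conditional probability mass function) `W x y = p(y | x)`. -/
def IsChannel (W : X → X → ℝ) : Prop :=
  ∀ x, W x ∈ stdSimplex ℝ X

/-- `E[d(X, X̂)]` when `X` has law `p` and `X̂` is the output of the channel `W`. -/
def channelDistortion (p : X → ℝ) (d : X → X → ℝ) (W : X → X → ℝ) : ℝ :=
  ∑ x, ∑ y, p x * W x y * d x y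

/-- The channels `W` with `E[d(X, X̂)] ≤ D`. -/
def feasibleChannels (p : X → ℝ) (d : X → X → ℝ) (D : ℝ) : Set (X → X → ℝ) :=
  {W | IsChannel W ∧ channelDistortion p d W ≤ D}

/-- The information rate-distortion function: the infimum of `I(X̂; X)` over all channels with
`E[d(X, X̂)] ≤ D`. It is `⊤` if there is no such channel. -/
def infoRDF (p : X → ℝ) (d : X → X → ℝ) (D : ℝ) : EReal :=
  ⨅ W ∈ feasibleChannels p d D, ((mutualInfo (fun x y => p x * W x y) : ℝ) : EReal)

/-- A feedforward code of block length `n` with `M` messages. At time `i` the decoder sees the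
message and the strictly earlier source samples `x 0, …, x (i - 1)`, and nothing else. -/
structure Code (X : Type*) (n M : ℕ) where
  enc : (Fin n → X) → Fin M
  dec : (i : Fin n) → Fin M → (Fin i → X) → X

/-- The `i`-th reconstruction produced by the code on the source block `x`. -/
def Code.reconstruct {X : Type*} {n M : ℕ} (C : Code X n M) (x : Fin n → X) (i : Fin n) : X :=
  C.dec i (C.enc x) (fun j => x (Fin.castLE i.isLt.le j))

/-- Expected average distortion `E[(1/n) ∑ i, d(X i, X̂ i)]` of the code when the source samples
are independent with common law `p`. -/
def Code.avgDistortion {n M : ℕ} (p : X → ℝ) (d : X → X → ℝ) (C : Code X n M) : ℝ :=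
  ∑ x : Fin n → X, (∏ i, p (x i)) * ((1 / (n : ℝ)) * ∑ i, d (x i) (C.reconstruct x i))

/-- `R` is achievable at distortion `D`: there is a sequence of feedforward codes of rate `R`
(messages are the integers `m` with `1 ≤ m ≤ 2 ^ (n R)`) with
`limsup E[(1/n) ∑ i, d(X i, X̂ i)] ≤ D`. -/
def Achievable (p : X → ℝ) (d : X → X → ℝ) (D R : ℝ) : Prop :=
  ∃ C : (n : ℕ) → Code X n ⌊(2 : ℝ) ^ ((n : ℝ) * R)⌋₊,
    ∀ ε > 0, ∀ᶠ n in Filter.atTop, (C n).avgDistortion p d ≤ D + ε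

/-- The operational feedforward rate-distortion function: the infimum of all achievable rates,
`⊤` if no rate is achievable. -/
def operRDF (p : X → ℝ) (d : X → X → ℝ) (D : ℝ) : EReal :=
  sInf ((fun R : ℝ => (R : EReal)) '' {R : ℝ | Achievable p d D R})

end Feedforward

end

/-! On a memoryless source, knowledge of past samples does not lower Shannon's rate, and codes that
ignore the past already reach it.

Converse. Averaging the joint law of sample and reconstruction over time keeps the first marginal
`p` and the distortion of the code. With `V` the backward channel of this average, `n` times its
mutual information (in nats) is the mean of `log (∏ V(xᵢ | x̂ᵢ) / ∏ p(xᵢ))`. For a fixed message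
each reconstruction is a function of the strict past, so `∏ V` is a sub-probability on source blocks
(`sum_prod_causal_le_one`), and over `M` messages the total mass is at most `M`. Averaging `log z ≤
z / M - 1 + log M` gives the bound `log M` (`Code.mutualInfo_jointLaw_le`). Compactness of the set
of channels then removes the slack in the distortion (`exists_channel_of_achievable`).

Achievability. Strictly above `I(W)`, random codewords drawn from the output law cover the source
(`exists_codebook`), with Chernoff bounds in place of typicality. The rate `I(W)` itself is reached
as well: if it is positive, mixing `W` with its output law lowers the information strictly at a
vanishing cost in distortion (`mutualInfo_mix_le`); if it is zero, a constant reconstruction does as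
well as `W`. Since a minimizing `W` exists, the infimum of the rates is attained. -/

namespace Feedforward

open Finset Filter Topology

/-! ### Sums of products over blocks -/

section ProductSums

theorem sum_sum_prod_eq_pow {A B : Type*} [Fintype A] [Fintype B] (a : A → B → ℝ) (n : ℕ) :
    ∑ x : Fin n → A, ∑ y : Fin n → B, ∏ i, a (x i) (y i) = (∑ x, ∑ y, a x y) ^ n := by
  classical
  rw [Fintype.sum_pow]
  refine sum_congr rfl fun x _ => ?_
  rw [Fintype.prod_sum]

theorem sum_prod_eq_one {A : Type*} [Fintype A] {p : A → ℝ} (hp : ∑ a, p a = 1) (n : ℕ) :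
    ∑ x : Fin n → A, ∏ i, p (x i) = 1 := by
  rw [← Fintype.sum_pow, hp, one_pow]

theorem sum_prod_mul_apply {A : Type*} [Fintype A] {p : A → ℝ} (hp : ∑ a, p a = 1) {n : ℕ}
    (φ : A → ℝ) (i : Fin n) :
    ∑ x : Fin n → A, (∏ j, p (x j)) * φ (x i) = ∑ a, p a * φ a := by
  classical
  have h : ∀ x : Fin n → A, (∏ j, p (x j)) * φ (x i) =
      ∏ j, p (x j) * (if j = i then φ (x j) else 1) := by
    intro x
    rw [prod_mul_distrib, prod_ite_eq' univ i (fun j => φ (x j))]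
    simp
  simp_rw [h]
  rw [← Fintype.prod_sum (fun j a => p a * (if j = i then φ a else 1)),
    prod_eq_single i (by intro j _ hj; simp [hj, hp]) (by simp)]
  simp

/-- A product of sub-probability kernels, each depending on the strict past only, has total mass
at most one. -/
theorem sum_prod_causal_le_one {A : Type*} [Fintype A] {n : ℕ}
    (K : (i : Fin n) → (Fin i → A) → A → ℝ) (h0 : ∀ i h a, 0 ≤ K i h a)
    (h1 : ∀ i h, ∑ a, K i h a ≤ 1) :
    ∑ x : Fin n → A, ∏ i, K i (fun j => x (Fin.castLE i.isLt.le j)) (x i) ≤ 1 := by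
  induction n with
  | zero => simp
  | succ n ih =>
    -- The last sample enters only the last kernel, so it can be summed out first.
    rw [← (Fin.snocEquiv (fun _ : Fin (n + 1) => A)).sum_comp, Fintype.sum_prod_type_right]
    calc _ = ∑ x : Fin n → A,
          (∏ i : Fin n, K i.castSucc (fun j => x (Fin.castLE i.isLt.le j)) (x i)) *
            ∑ a, K (Fin.last n) x a := by
          refine sum_congr rfl fun x _ => ?_
          rw [mul_sum]
          refine sum_congr rfl fun a _ => ?_
          rw [Fin.prod_univ_castSucc]
          have e : ∀ k : Fin n, Fin.snoc (α := fun _ => A) x a k.castSucc = x k :=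
            fun k => Fin.snoc_castSucc (α := fun _ => A) a x k
          have e1 : ∀ i : Fin n, (fun j : Fin i.castSucc =>
              Fin.snoc (α := fun _ => A) x a (Fin.castLE i.castSucc.isLt.le j)) =
              fun j : Fin i => x (Fin.castLE i.isLt.le j) := fun i => funext fun j =>
            e (Fin.castLE i.isLt.le j)
          have e2 : (fun j : Fin (Fin.last n) =>
              Fin.snoc (α := fun _ => A) x a (Fin.castLE (Fin.last n).isLt.le j)) = x :=
            funext fun j => e j
          have e3 : Fin.snoc (α := fun _ => A) x a (Fin.last n) = a :=
            Fin.snoc_last (α := fun _ => A) a x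
          simp only [Fin.snocEquiv_apply]
          congr 1
          · refine prod_congr rfl fun i _ => ?_
            rw [e]
            exact congrArg (fun h => K i.castSucc h (x i)) (e1 i)
          · rw [e3]
            exact congrArg (fun h => K (Fin.last n) h a) e2
      _ ≤ ∑ x : Fin n → A,
          (∏ i : Fin n, K i.castSucc (fun j => x (Fin.castLE i.isLt.le j)) (x i)) * 1 := by
          gcongr with x
          · exact prod_nonneg fun i _ => h0 _ _ _
          · exact h1 _ _
      _ ≤ 1 := by
          simp only [mul_one]
          exact ih (fun i => K i.castSucc) (fun i => h0 i.castSucc) (fun i => h1 i.castSucc)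

end ProductSums

/-! ### Mutual information of a channel: sign, continuity, mixing -/

section MutualInformation

variable {X : Type*} [Fintype X]

/-- The output law of the channel `W` with input law `p`. -/
def outputLaw (p : X → ℝ) (W : X → X → ℝ) (y : X) : ℝ := ∑ x, p x * W x y

variable {p : X → ℝ} {W : X → X → ℝ}

theorem outputLaw_nonneg (hp : p ∈ stdSimplex ℝ X) (hW : IsChannel W) (y : X) :
    0 ≤ outputLaw p W y :=
  sum_nonneg fun x _ => mul_nonneg (hp.1 x) ((hW x).1 y)

theorem sum_outputLaw (hp : p ∈ stdSimplex ℝ X) (hW : IsChannel W) :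
    ∑ y, outputLaw p W y = 1 := by
  unfold outputLaw
  rw [sum_comm]
  simp_rw [← mul_sum, (hW _).2, mul_one, hp.2]

theorem mul_le_outputLaw (hp : p ∈ stdSimplex ℝ X) (hW : IsChannel W) (x y : X) :
    p x * W x y ≤ outputLaw p W y :=
  single_le_sum (f := fun x => p x * W x y)
    (fun x _ => mul_nonneg (hp.1 x) ((hW x).1 y)) (mem_univ x)

theorem eq_zero_of_marginals_mul_eq_zero (hp : p ∈ stdSimplex ℝ X) (hW : IsChannel W) {x y : X}
    (h : p x * outputLaw p W y = 0) : p x * W x y = 0 := by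
  rcases mul_eq_zero.1 h with h | h
  · simp [h]
  · exact le_antisymm (h ▸ mul_le_outputLaw hp hW x y) (mul_nonneg (hp.1 x) ((hW x).1 y))

theorem mutualInfo_channel_mul_log_two (hW : IsChannel W) :
    mutualInfo (fun x y => p x * W x y) * Real.log 2 =
      ∑ x, ∑ y, p x * W x y * Real.log (p x * W x y / (p x * outputLaw p W y)) := by
  have h2 : Real.log 2 ≠ 0 := by positivity
  unfold mutualInfo outputLaw
  rw [sum_mul]
  refine sum_congr rfl fun x _ => ?_
  rw [sum_mul]
  refine sum_congr rfl fun y _ => ?_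
  rw [← mul_sum, (hW x).2, mul_one, Real.logb]
  field_simp

/-- The linear terms that `klFun` adds to `t log t` cancel in total, both joint laws having mass
one. Each summand is now nonnegative and detects independence, which the logarithmic terms alone do
not. -/
theorem mutualInfo_channel_eq_klFun (hp : p ∈ stdSimplex ℝ X) (hW : IsChannel W) :
    mutualInfo (fun x y => p x * W x y) * Real.log 2 =
      ∑ x, ∑ y, p x * outputLaw p W y *
        InformationTheory.klFun (p x * W x y / (p x * outputLaw p W y)) := by
  have h : ∀ x y, p x * outputLaw p W y *
      InformationTheory.klFun (p x * W x y / (p x * outputLaw p W y)) =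
      p x * W x y * Real.log (p x * W x y / (p x * outputLaw p W y)) +
        (p x * outputLaw p W y - p x * W x y) := by
    intro x y
    unfold InformationTheory.klFun
    by_cases h : p x * outputLaw p W y = 0
    · rw [eq_zero_of_marginals_mul_eq_zero hp hW h, h]; simp
    · generalize p x * outputLaw p W y = c at *
      field_simp
      ring
  simp_rw [h, sum_add_distrib]
  rw [mutualInfo_channel_mul_log_two hW]
  have : ∑ x, ∑ y, (p x * outputLaw p W y - p x * W x y) = 0 := by
    simp_rw [sum_sub_distrib, ← mul_sum, sum_outputLaw hp hW, (hW _).2]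
    simp
  rw [this, add_zero]

theorem klFun_term_nonneg (hp : p ∈ stdSimplex ℝ X) (hW : IsChannel W) (x y : X) :
    0 ≤ p x * outputLaw p W y *
        InformationTheory.klFun (p x * W x y / (p x * outputLaw p W y)) := by
  have h := mul_nonneg (hp.1 x) (outputLaw_nonneg hp hW y)
  exact mul_nonneg h (InformationTheory.klFun_nonneg
    (div_nonneg (mul_nonneg (hp.1 x) ((hW x).1 y)) h))

theorem mutualInfo_channel_nonneg (hp : p ∈ stdSimplex ℝ X) (hW : IsChannel W) :
    0 ≤ mutualInfo (fun x y => p x * W x y) := by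
  have h2 : 0 < Real.log 2 := by positivity
  refine nonneg_of_mul_nonneg_left ?_ h2
  rw [mutualInfo_channel_eq_klFun hp hW]
  exact sum_nonneg fun x _ => sum_nonneg fun y _ => klFun_term_nonneg hp hW x y

theorem eq_mul_outputLaw_of_mutualInfo_eq_zero (hp : p ∈ stdSimplex ℝ X) (hW : IsChannel W)
    (h : mutualInfo (fun x y => p x * W x y) = 0) (x y : X) :
    p x * W x y = p x * outputLaw p W y := by
  have hk := mutualInfo_channel_eq_klFun hp hW
  rw [h, zero_mul, eq_comm, sum_eq_zero_iff_of_nonneg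
    (fun x _ => sum_nonneg fun y _ => klFun_term_nonneg hp hW x y)] at hk
  have hxy := (sum_eq_zero_iff_of_nonneg (fun y _ => klFun_term_nonneg hp hW x y)).1
    (hk x (mem_univ x)) y (mem_univ y)
  by_cases h0 : p x * outputLaw p W y = 0
  · rw [eq_zero_of_marginals_mul_eq_zero hp hW h0, h0]
  · have := (InformationTheory.klFun_eq_zero_iff (div_nonneg (mul_nonneg (hp.1 x) ((hW x).1 y))
      (mul_nonneg (hp.1 x) (outputLaw_nonneg hp hW y)))).1 ((mul_eq_zero.1 hxy).resolve_left h0)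
    exact (div_eq_one_iff_eq h0).1 this

/-- Mutual information as a combination of entropies. -/
theorem mutualInfo_channel_eq_sum_mul_log (hp : p ∈ stdSimplex ℝ X) (hW : IsChannel W) :
    mutualInfo (fun x y => p x * W x y) =
      ((∑ x, ∑ y, p x * W x y * Real.log (p x * W x y)) - ∑ x, p x * Real.log (p x)
        - ∑ y, outputLaw p W y * Real.log (outputLaw p W y)) / Real.log 2 := by
  have h2 : Real.log 2 ≠ 0 := by positivity
  rw [eq_div_iff h2, mutualInfo_channel_mul_log_two hW]
  have h : ∀ x y, p x * W x y * Real.log (p x * W x y / (p x * outputLaw p W y)) =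
      p x * W x y * Real.log (p x * W x y) - p x * W x y * Real.log (p x)
        - p x * W x y * Real.log (outputLaw p W y) := by
    intro x y
    by_cases h : p x * W x y = 0
    · simp [h]
    · have h' : p x * outputLaw p W y ≠ 0 := fun h0 =>
        h (eq_zero_of_marginals_mul_eq_zero hp hW h0)
      rw [Real.log_div h h', Real.log_mul (left_ne_zero_of_mul h') (right_ne_zero_of_mul h')]
      ring
  simp_rw [h, sum_sub_distrib]
  congr 1
  · congr 1
    refine sum_congr rfl fun x _ => ?_
    rw [← sum_mul, ← mul_sum, (hW x).2, mul_one]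
  · rw [sum_comm]
    refine sum_congr rfl fun y _ => ?_
    rw [← sum_mul, outputLaw]

/-- The entropy form involves only `t log t`, which is continuous at `0`, whereas the log-ratio form
is singular there. -/
theorem continuousOn_mutualInfo_channel (hp : p ∈ stdSimplex ℝ X) :
    ContinuousOn (fun W : X → X → ℝ => mutualInfo (fun x y => p x * W x y)) {W | IsChannel W} := by
  refine ContinuousOn.congr (f := fun W : X → X → ℝ =>
    ((∑ x, ∑ y, p x * W x y * Real.log (p x * W x y)) - ∑ x, p x * Real.log (p x)
        - ∑ y, outputLaw p W y * Real.log (outputLaw p W y)) / Real.log 2) ?_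
    (fun W hW => mutualInfo_channel_eq_sum_mul_log hp hW)
  refine Continuous.continuousOn ?_
  have hq : ∀ y, Continuous fun W : X → X → ℝ => outputLaw p W y := by
    intro y; unfold outputLaw; fun_prop
  have h1 : ∀ x y, Continuous fun W : X → X → ℝ => p x * W x y * Real.log (p x * W x y) :=
    fun x y => Real.continuous_mul_log.comp
      (show Continuous fun W : X → X → ℝ => p x * W x y by fun_prop)
  have h3 : ∀ y, Continuous fun W : X → X → ℝ =>
      outputLaw p W y * Real.log (outputLaw p W y) :=
    fun y => Real.continuous_mul_log.comp (hq y)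
  fun_prop

theorem isCompact_isChannel : IsCompact {W : X → X → ℝ | IsChannel W} := by
  have := isCompact_univ_pi fun _ : X => isCompact_stdSimplex ℝ X
  convert this using 1
  ext W
  simp [IsChannel]

theorem continuous_channelDistortion (p : X → ℝ) (d : X → X → ℝ) :
    Continuous (channelDistortion p d) := by
  unfold channelDistortion
  fun_prop

/-- Mixing a channel with its own output law scales mutual information down. -/
theorem mutualInfo_mix_le (hp : p ∈ stdSimplex ℝ X) (hW : IsChannel W) {t : ℝ}
    (ht : t ∈ Set.Icc (0 : ℝ) 1) :
    IsChannel (fun x y => (1 - t) * W x y + t * outputLaw p W y) ∧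
    mutualInfo (fun x y => p x * ((1 - t) * W x y + t * outputLaw p W y)) ≤
      (1 - t) * mutualInfo (fun x y => p x * W x y) := by
  have hV : IsChannel (fun x y => (1 - t) * W x y + t * outputLaw p W y) := by
    refine fun x => ⟨fun y => ?_, ?_⟩
    · exact add_nonneg (mul_nonneg (by linarith [ht.2]) ((hW x).1 y))
        (mul_nonneg ht.1 (outputLaw_nonneg hp hW y))
    · rw [sum_add_distrib, ← mul_sum, ← mul_sum, (hW x).2, sum_outputLaw hp hW]; ring
  refine ⟨hV, ?_⟩
  -- Mixing preserves the output law, so the reference product law is unchanged and convexity of `t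
  -- log t`, which vanishes at `1`, suffices term by term.
  have hq : outputLaw p (fun x y => (1 - t) * W x y + t * outputLaw p W y) = outputLaw p W := by
    funext y
    calc _ = ∑ x, ((1 - t) * (p x * W x y) + t * outputLaw p W y * p x) :=
          sum_congr rfl fun x _ => by ring
      _ = (1 - t) * outputLaw p W y + t * outputLaw p W y * ∑ x, p x := by
          rw [sum_add_distrib, ← mul_sum, ← mul_sum]; rfl
      _ = _ := by rw [hp.2]; ring
  have h2 : 0 < Real.log 2 := by positivity
  refine le_of_mul_le_mul_right ?_ h2
  rw [mul_assoc, mutualInfo_channel_mul_log_two hW, mutualInfo_channel_mul_log_two hV, hq, mul_sum]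
  refine sum_le_sum fun x _ => ?_
  rw [mul_sum]
  refine sum_le_sum fun y _ => ?_
  by_cases h : p x * outputLaw p W y = 0
  · have := eq_zero_of_marginals_mul_eq_zero hp hW h
    have h' : p x * ((1 - t) * W x y + t * outputLaw p W y) = 0 := by
      linear_combination (1 - t) * this + t * h
    simp [this, h']
  · have hc : 0 ≤ p x * outputLaw p W y := mul_nonneg (hp.1 x) (outputLaw_nonneg hp hW y)
    have hz : 0 ≤ p x * W x y / (p x * outputLaw p W y) :=
      div_nonneg (mul_nonneg (hp.1 x) ((hW x).1 y)) hc
    have := Real.convexOn_mul_log.2 (Set.mem_Ici.2 hz) (Set.mem_Ici.2 zero_le_one)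
      (by linarith [ht.2] : 0 ≤ 1 - t) ht.1 (by ring)
    simp only [smul_eq_mul, mul_one, Real.log_one, mul_zero, add_zero] at this
    have e : p x * ((1 - t) * W x y + t * outputLaw p W y) =
        p x * outputLaw p W y * ((1 - t) * (p x * W x y / (p x * outputLaw p W y)) + t) := by
      linear_combination -(1 - t) * mul_div_cancel₀ (p x * W x y) h
    rw [e, mul_div_cancel_left₀ _ h, mul_assoc]
    refine (mul_le_mul_of_nonneg_left this hc).trans (le_of_eq ?_)
    rw [mul_left_comm, ← mul_assoc (p x * outputLaw p W y), mul_div_cancel₀ _ h]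

end MutualInformation

/-! ### Converse: from feedforward codes to test channels -/

section Converse

variable {X : Type*} [Fintype X]

open Classical in
/-- The time-averaged joint law of source sample and reconstruction. -/
noncomputable def Code.jointLaw {n M : ℕ} (p : X → ℝ) (C : Code X n M) (a b : X) : ℝ :=
  ∑ x : Fin n → X, (∏ i, p (x i)) *
    ((1 / (n : ℝ)) * ∑ i, if x i = a ∧ C.reconstruct x i = b then 1 else 0)

/-- Used with `φ` an indicator (first marginal), the distortion, and the information density. -/
theorem Code.sum_jointLaw_mul {n M : ℕ} (p : X → ℝ) (C : Code X n M) (φ : X → X → ℝ) :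
    ∑ a, ∑ b, C.jointLaw p a b * φ a b =
      ∑ x : Fin n → X, (∏ i, p (x i)) * ((1 / (n : ℝ)) * ∑ i, φ (x i) (C.reconstruct x i)) := by
  classical
  unfold Code.jointLaw
  simp_rw [sum_mul]
  simp_rw [sum_comm (s := (univ : Finset X)) (t := (univ : Finset (Fin n → X)))]
  refine sum_congr rfl fun x _ => ?_
  simp_rw [mul_assoc, ← mul_sum, sum_mul]
  congr 2
  simp_rw [sum_comm (s := (univ : Finset X)) (t := (univ : Finset (Fin n)))]
  refine sum_congr rfl fun i _ => ?_
  rw [sum_eq_single (x i), sum_eq_single (C.reconstruct x i)]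
  · simp
  · intro b _ hb; simp [hb.symm]
  · simp
  · intro a _ ha; simp [ha.symm]
  · simp

theorem Code.jointLaw_nonneg {n M : ℕ} {p : X → ℝ} (hp : p ∈ stdSimplex ℝ X) (C : Code X n M)
    (a b : X) : 0 ≤ C.jointLaw p a b := by
  unfold Code.jointLaw
  refine sum_nonneg fun x _ => mul_nonneg (prod_nonneg fun i _ => hp.1 _) (mul_nonneg (by positivity)
    (sum_nonneg fun i _ => ?_))
  split_ifs <;> norm_num

theorem Code.sum_jointLaw_right {n M : ℕ} (hn : n ≠ 0) {p : X → ℝ} (hp : p ∈ stdSimplex ℝ X)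
    (C : Code X n M) (a : X) : ∑ b, C.jointLaw p a b = p a := by
  classical
  have hn' : (n : ℝ) ≠ 0 := Nat.cast_ne_zero.2 hn
  have h := C.sum_jointLaw_mul p (fun a' _ => if a' = a then 1 else 0)
  rw [sum_eq_single a (by intro a' _ ha; simp [ha]) (by simp)] at h
  simp only [if_true, mul_one] at h
  rw [h]
  simp_rw [mul_sum, mul_left_comm _ (1 / (n : ℝ))]
  rw [sum_comm]
  simp_rw [← mul_sum, sum_prod_mul_apply hp.2 (fun a' => if a' = a then (1 : ℝ) else 0)]
  simp [hn']

/-- Keeps the logarithms in the converse away from zero arguments on blocks of positive probability.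
-/
theorem Code.jointLaw_pos {n M : ℕ} {p : X → ℝ} (hp : p ∈ stdSimplex ℝ X) (C : Code X n M)
    {x : Fin n → X} (hx : 0 < ∏ i, p (x i)) (i : Fin n) :
    0 < C.jointLaw p (x i) (C.reconstruct x i) := by
  classical
  have hn : 0 < (n : ℝ) := Nat.cast_pos.2 (Fin.pos i)
  have hs : ∀ (x' : Fin n → X) (j : Fin n), (0 : ℝ) ≤
      if x' j = x i ∧ C.reconstruct x' j = C.reconstruct x i then 1 else 0 := by
    intro x' j; split_ifs <;> norm_num
  unfold Code.jointLaw
  refine sum_pos' (fun x' _ => mul_nonneg (prod_nonneg fun i _ => hp.1 _)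
    (mul_nonneg (by positivity) (sum_nonneg fun j _ => ?_))) ⟨x, mem_univ x, ?_⟩
  · convert hs x' j
  · refine mul_pos hx (mul_pos (by positivity) (sum_pos' (fun j _ => ?_) ⟨i, mem_univ i, by simp⟩))
    convert hs x j

/-- The mutual information of the averaged joint law of a feedforward code with `M` messages is
at most `log M / n`. -/
theorem Code.mutualInfo_jointLaw_le {n M : ℕ} (hn : n ≠ 0) (hM : M ≠ 0) {p : X → ℝ}
    (hp : p ∈ stdSimplex ℝ X) (C : Code X n M) :
    n * (mutualInfo (C.jointLaw p) * Real.log 2) ≤ Real.log M := by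
  classical
  have hn' : (n : ℝ) ≠ 0 := Nat.cast_ne_zero.2 hn
  have hM' : (0 : ℝ) < M := by positivity
  have h2 : Real.log 2 ≠ 0 := by positivity
  set q : X → ℝ := fun b => ∑ a, C.jointLaw p a b with hq
  have hJ := C.jointLaw_nonneg hp
  have hq0 : ∀ b, 0 ≤ q b := fun b => sum_nonneg fun a _ => hJ a b
  -- The backward channel. Where `q b = 0` its column is zero, hence only `≤ 1` below.
  set V : X → X → ℝ := fun a b => C.jointLaw p a b / q b with hV
  have hV0 : ∀ a b, 0 ≤ V a b := fun a b => div_nonneg (hJ a b) (hq0 b)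
  have hV1 : ∀ b, ∑ a, V a b ≤ 1 := by
    intro b
    simp only [hV, ← sum_div]
    exact div_self_le_one _
  have hI : mutualInfo (C.jointLaw p) * Real.log 2 =
      ∑ a, ∑ b, C.jointLaw p a b * Real.log (V a b / p a) := by
    unfold mutualInfo
    rw [sum_mul]
    refine sum_congr rfl fun a _ => ?_
    rw [sum_mul]
    refine sum_congr rfl fun b _ => ?_
    rw [C.sum_jointLaw_right hn hp, Real.logb, mul_assoc, div_mul_cancel₀ _ h2,
      show V a b / p a = C.jointLaw p a b / (p a * q b) by
        rw [mul_comm]; exact div_div _ _ _]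
  rw [hI, C.sum_jointLaw_mul p, mul_sum]
  -- The tangent bound for `log` at `M`, applied to the ratio of `∏ V` to `∏ p`.
  have key : ∀ x : Fin n → X,
      (n : ℝ) * ((∏ i, p (x i)) * (1 / (n : ℝ) *
        ∑ i, Real.log (V (x i) (C.reconstruct x i) / p (x i)))) ≤
      (∏ i, V (x i) (C.reconstruct x i)) / M + (∏ i, p (x i)) * (Real.log M - 1) := by
    intro x
    have hP0 : 0 ≤ ∏ i, p (x i) := prod_nonneg fun i _ => hp.1 _
    rcases hP0.eq_or_lt with hP | hP
    · rw [← hP]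
      simp only [zero_mul, mul_zero, add_zero]
      exact div_nonneg (prod_nonneg fun i _ => hV0 _ _) hM'.le
    · have hpx : ∀ i, 0 < p (x i) := fun i => (hp.1 _).lt_of_ne' fun h =>
        hP.ne' (prod_eq_zero (mem_univ i) h)
      have hVx : ∀ i, 0 < V (x i) (C.reconstruct x i) := fun i =>
        div_pos (C.jointLaw_pos hp hP i) ((C.jointLaw_pos hp hP i).trans_le
          (single_le_sum (f := fun a => C.jointLaw p a (C.reconstruct x i))
            (fun a _ => hJ a _) (mem_univ (x i))))
      have hVP : 0 < ∏ i, V (x i) (C.reconstruct x i) := prod_pos fun i _ => hVx i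
      rw [← Real.log_prod (fun i _ => (div_pos (hVx i) (hpx i)).ne'), prod_div_distrib]
      set P := ∏ i, p (x i)
      set Q := ∏ i, V (x i) (C.reconstruct x i)
      have hlog := Real.log_le_sub_one_of_pos (div_pos (div_pos hVP hP) hM')
      rw [Real.log_div (div_pos hVP hP).ne' hM'.ne'] at hlog
      have : P * Real.log (Q / P) ≤ P * (Q / P / M - 1 + Real.log M) := by
        gcongr; linarith
      calc _ = P * Real.log (Q / P) := by field_simp
        _ ≤ _ := this
        _ = _ := by field_simp; ring
  refine (sum_le_sum fun x _ => key x).trans ?_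
  rw [sum_add_distrib, ← sum_mul, sum_prod_eq_one hp.2, ← sum_div]
  -- Replacing the encoder's choice by a sum over all messages frees the reconstruction from the
  -- future samples seen by the encoder. What remains is causal.
  have hsum : ∑ x : Fin n → X, ∏ i, V (x i) (C.reconstruct x i) ≤ M := by
    calc _ ≤ ∑ x : Fin n → X, ∑ m : Fin M,
          ∏ i, V (x i) (C.dec i m (fun j => x (Fin.castLE i.isLt.le j))) :=
          sum_le_sum fun x _ => single_le_sum
            (f := fun m => ∏ i, V (x i) (C.dec i m (fun j => x (Fin.castLE i.isLt.le j))))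
            (fun m _ => prod_nonneg fun i _ => hV0 _ _) (mem_univ (C.enc x))
      _ = ∑ m : Fin M, ∑ x : Fin n → X,
          ∏ i, V (x i) (C.dec i m (fun j => x (Fin.castLE i.isLt.le j))) := sum_comm
      _ ≤ ∑ _m : Fin M, 1 := sum_le_sum fun m _ =>
          sum_prod_causal_le_one (fun i h a => V a (C.dec i m h)) (fun i h a => hV0 _ _)
            (fun i h => hV1 _)
      _ = M := by simp
  have := (div_le_one hM').2 hsum
  linarith

/-- A feedforward code yields a test channel with the same distortion. -/
theorem Code.exists_channel {n M : ℕ} (hn : n ≠ 0) (hM : M ≠ 0) {p : X → ℝ}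
    (hp : p ∈ stdSimplex ℝ X) (d : X → X → ℝ) (C : Code X n M) :
    ∃ W, IsChannel W ∧ n * (mutualInfo (fun x y => p x * W x y) * Real.log 2) ≤ Real.log M ∧
      channelDistortion p d W = C.avgDistortion p d := by
  classical
  have hJ := C.jointLaw_nonneg hp
  have hs := C.sum_jointLaw_right hn hp
  -- Rows at letters of probability zero are immaterial; `p` serves as a valid one.
  set W : X → X → ℝ := fun a b => if p a = 0 then p b else C.jointLaw p a b / p a with hW
  have hpW : (fun a b => p a * W a b) = C.jointLaw p := by
    funext a b
    by_cases h : p a = 0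
    · rw [h, zero_mul]
      exact ((sum_eq_zero_iff_of_nonneg fun b _ => hJ a b).1 ((hs a).trans h) b (mem_univ b)).symm
    · simp only [hW, if_neg h]
      rw [mul_div_cancel₀ _ h]
  refine ⟨W, fun a => ?_, ?_, ?_⟩
  · by_cases h : p a = 0
    · simpa [hW, h] using hp
    · simp only [hW, if_neg h]
      exact ⟨fun b => div_nonneg (hJ a b) (hp.1 a), by rw [← sum_div, hs, div_self h]⟩
  · rw [hpW]
    exact C.mutualInfo_jointLaw_le hn hM hp
  · calc channelDistortion p d W = ∑ a, ∑ b, C.jointLaw p a b * d a b := by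
          rw [← hpW]; rfl
      _ = _ := C.sum_jointLaw_mul p d

theorem nonempty_of_mem_stdSimplex {p : X → ℝ} (hp : p ∈ stdSimplex ℝ X) : Nonempty X := by
  by_contra h
  rw [not_nonempty_iff] at h
  simpa using hp.2

/-- The channels of information at most `R` form a compact set, so a channel of least distortion
exists there; it beats `D + ε` for every `ε`. -/
theorem exists_channel_of_achievable {p : X → ℝ} (hp : p ∈ stdSimplex ℝ X) {d : X → X → ℝ}
    {D R : ℝ} (h : Achievable p d D R) :
    ∃ W ∈ feasibleChannels p d D, mutualInfo (fun x y => p x * W x y) ≤ R := by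
  obtain ⟨C, hC⟩ := h
  have h2 : 0 < Real.log 2 := by positivity
  have hX := nonempty_of_mem_stdSimplex hp
  have hε : ∀ ε > 0, ∃ W, (IsChannel W ∧ mutualInfo (fun x y => p x * W x y) ≤ R) ∧
      channelDistortion p d W ≤ D + ε := by
    intro ε hε
    obtain ⟨n, hn, hn0⟩ := ((hC ε hε).and (eventually_ne_atTop 0)).exists
    -- An encoder needs at least one message to map to, which covers negative `R`.
    have hM : ⌊(2 : ℝ) ^ ((n : ℝ) * R)⌋₊ ≠ 0 := fun h0 =>
      (Fin.pos ((C n).enc fun _ => Classical.arbitrary X)).ne' h0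
    obtain ⟨W, hW, hI, hD⟩ := (C n).exists_channel hn0 hM hp d
    refine ⟨W, ⟨hW, ?_⟩, hD ▸ hn⟩
    have hlog : Real.log ⌊(2 : ℝ) ^ ((n : ℝ) * R)⌋₊ ≤ n * (R * Real.log 2) := by
      refine (Real.log_le_log (by positivity) (Nat.floor_le (by positivity))).trans (le_of_eq ?_)
      rw [Real.log_rpow two_pos, mul_assoc]
    exact le_of_mul_le_mul_right
      (le_of_mul_le_mul_left (hI.trans hlog) (by positivity : (0 : ℝ) < n)) h2
  have hK : IsCompact {W : X → X → ℝ | IsChannel W ∧ mutualInfo (fun x y => p x * W x y) ≤ R} :=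
    isCompact_isChannel.of_isClosed_subset
      ((continuousOn_mutualInfo_channel hp).preimage_isClosed_of_isClosed
        isCompact_isChannel.isClosed isClosed_Iic) fun W hW => hW.1
  obtain ⟨W, hW, hmin⟩ := hK.exists_isMinOn (let ⟨W, hW, _⟩ := hε 1 one_pos; ⟨W, hW⟩)
    (continuous_channelDistortion p d).continuousOn
  refine ⟨W, ⟨hW.1, le_of_forall_pos_le_add fun ε he => ?_⟩, hW.2⟩
  obtain ⟨W', hW', hD⟩ := hε ε he
  exact (hmin hW').trans hD

end Converse

/-! ### Random coding above the mutual information -/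

section RandomCoding

open Classical in
/-- Chernoff bound for the upper tail of the empirical mean of `ψ` under a product law. -/
theorem exists_chernoff_bound {A B : Type*} [Fintype A] [Fintype B] {J : A → B → ℝ}
    (hJ : ∀ a b, 0 ≤ J a b) (hJ1 : ∑ a, ∑ b, J a b = 1) (ψ : A → B → ℝ) {c : ℝ}
    (hc : ∑ a, ∑ b, J a b * ψ a b < c) :
    ∃ r : ℝ, 0 ≤ r ∧ r < 1 ∧ ∀ n : ℕ, ∑ x : Fin n → A, ∑ y : Fin n → B,
      (∏ i, J (x i) (y i)) * (if n * c < ∑ i, ψ (x i) (y i) then 1 else 0) ≤ r ^ n := by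
  set f : ℝ → ℝ := fun t => ∑ a, ∑ b, J a b * Real.exp (t * (ψ a b - c)) with hf
  have hf0 : f 0 = 1 := by simp [hf, hJ1]
  have hd : HasDerivAt f (∑ a, ∑ b, J a b * (ψ a b - c)) 0 := by
    refine HasDerivAt.fun_sum fun a _ => HasDerivAt.fun_sum fun b _ => ?_
    have := ((hasDerivAt_id (0 : ℝ)).mul_const (ψ a b - c)).exp.const_mul (J a b)
    simpa using this
  have hneg : ∑ a, ∑ b, J a b * (ψ a b - c) < 0 := by
    simp_rw [mul_sub, sum_sub_distrib, ← sum_mul, hJ1]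
    linarith
  -- The moment generating function of `ψ - c` equals `1` at `0` with negative slope, so it is below
  -- `1` at some `t > 0`; that value is `r`.
  have hev := hd.tendsto_slope_zero_right.eventually (gt_mem_nhds hneg)
  obtain ⟨t, ht, ht0⟩ := (hev.and self_mem_nhdsWithin).exists
  have ht0 : 0 < t := ht0
  have hft : f t < 1 := by
    rw [zero_add, hf0, smul_eq_mul] at ht
    by_contra hcon
    exact ht.not_ge (mul_nonneg (inv_nonneg.2 ht0.le) (by linarith))
  refine ⟨f t, sum_nonneg fun a _ => sum_nonneg fun b _ => mul_nonneg (hJ a b)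
    (Real.exp_pos _).le, hft, fun n => ?_⟩
  rw [hf, ← sum_sum_prod_eq_pow (fun a b => J a b * Real.exp (t * (ψ a b - c)))]
  refine sum_le_sum fun x _ => sum_le_sum fun y _ => ?_
  rw [prod_mul_distrib, ← Real.exp_sum]
  refine mul_le_mul_of_nonneg_left ?_ (prod_nonneg fun i _ => hJ _ _)
  split_ifs with h
  · refine Real.one_le_exp ?_
    rw [← mul_sum, sum_sub_distrib]
    refine mul_nonneg ht0.le ?_
    simp only [sum_const, card_univ, Fintype.card_fin, nsmul_eq_mul]
    linarith
  · exact (Real.exp_pos _).le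

open Classical in
/-- One-shot covering lemma, by random coding with law `Q`. -/
theorem exists_codebook {A B : Type*} [Fintype A] [Fintype B] {P : A → ℝ} {Q : B → ℝ}
    {V : A → B → ℝ} (hP : P ∈ stdSimplex ℝ A) (hQ : Q ∈ stdSimplex ℝ B)
    (hV : ∀ a, V a ∈ stdSimplex ℝ B) (G : A → B → Prop) {L : ℝ} (hL : 0 < L)
    (hG : ∀ a b, G a b → P a * V a b ≤ L * (P a * Q b)) (M : ℕ) :
    ∃ cb : Fin M → B, ∑ a, P a * (if ∀ m, ¬ G a (cb m) then 1 else 0) ≤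
      ∑ a, ∑ b, P a * V a b * (if G a b then 0 else 1) + Real.exp (-(M / L)) := by
  set bound := ∑ a, ∑ b, P a * V a b * (if G a b then 0 else 1) + Real.exp (-(M / L))
  have havg : ∑ cb : Fin M → B, (∏ m, Q (cb m)) *
      ∑ a, P a * (if ∀ m, ¬ G a (cb m) then 1 else 0) ≤ bound := by
    -- The codewords are independent, so all `M` of them miss `a` with probability the `M`-th power
    -- of one miss.
    have hsum : ∑ cb : Fin M → B, (∏ m, Q (cb m)) *
        ∑ a, P a * (if ∀ m, ¬ G a (cb m) then 1 else 0) =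
        ∑ a, P a * (∑ b, Q b * (if G a b then 0 else 1)) ^ M := by
      simp_rw [mul_sum]
      rw [sum_comm]
      refine sum_congr rfl fun a _ => ?_
      rw [Fintype.sum_pow, mul_sum]
      refine sum_congr rfl fun cb _ => ?_
      rw [prod_mul_distrib, mul_left_comm]
      congr 2
      by_cases h : ∀ m, ¬ G a (cb m)
      · simp [h]
      · rw [if_neg h]
        push Not at h
        obtain ⟨m, hm⟩ := h
        symm
        exact prod_eq_zero (mem_univ m) (by simp [hm])
    have hterm : ∀ a, P a * (∑ b, Q b * (if G a b then 0 else 1)) ^ M ≤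
        ∑ b, P a * V a b * (if G a b then 0 else 1) + P a * Real.exp (-(M / L)) := by
      intro a
      rcases (hP.1 a).eq_or_lt with h | h
      · simp [← h]
      simp_rw [mul_assoc]
      rw [← mul_sum, ← mul_add]
      refine mul_le_mul_of_nonneg_left ?_ h.le
      have hsplit : ∀ U : B → ℝ, U ∈ stdSimplex ℝ B →
          ∑ b, U b * (if G a b then (0 : ℝ) else 1) = 1 - ∑ b, U b * (if G a b then 1 else 0) := by
        intro U hU
        rw [eq_sub_iff_add_eq, ← sum_add_distrib]
        conv_rhs => rw [← hU.2]
        refine sum_congr rfl fun b _ => ?_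
        split_ifs <;> ring
      have hnn : ∀ U : B → ℝ, U ∈ stdSimplex ℝ B →
          0 ≤ ∑ b, U b * (if G a b then (0 : ℝ) else 1) := fun U hU =>
        sum_nonneg fun b _ => mul_nonneg (hU.1 b) (by split_ifs <;> norm_num)
      have hα0 : 0 ≤ ∑ b, V a b * (if G a b then (1 : ℝ) else 0) :=
        sum_nonneg fun b _ => mul_nonneg ((hV a).1 b) (by split_ifs <;> norm_num)
      have hα1 := hnn _ (hV a)
      have hQ0 := hnn _ hQ
      rw [hsplit _ hQ] at hQ0 ⊢
      rw [hsplit _ (hV a)] at hα1 ⊢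
      have hαβ : (∑ b, V a b * (if G a b then (1 : ℝ) else 0)) / L ≤
          ∑ b, Q b * (if G a b then (1 : ℝ) else 0) := by
        rw [div_le_iff₀ hL, sum_mul]
        refine sum_le_sum fun b _ => ?_
        split_ifs with hg
        · have := hG a b hg
          rw [mul_left_comm] at this
          have := le_of_mul_le_mul_left this h
          linarith
        · simp
      set α := ∑ b, V a b * (if G a b then (1 : ℝ) else 0)
      set β := ∑ b, Q b * (if G a b then (1 : ℝ) else 0)
      -- The chord of `exp` from `-(M / L)` to `0`, with weights `α` and `1 - α`, separates the miss
      -- probability under `V` from the codebook-size error.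
      have hconv := convexOn_exp.2 (Set.mem_univ (0 : ℝ)) (Set.mem_univ (-(M / L)))
        hα1 hα0 (by ring)
      simp only [smul_eq_mul, mul_zero, zero_add, Real.exp_zero, mul_one] at hconv
      calc (1 - β) ^ M ≤ Real.exp (-β) ^ M := by
            gcongr
            linarith [Real.add_one_le_exp (-β)]
        _ = Real.exp (-(M * β)) := by rw [← Real.exp_nat_mul]; ring_nf
        _ ≤ Real.exp (α * -(M / L)) := by
            refine Real.exp_le_exp.2 ?_
            have : (M : ℝ) * (α / L) ≤ M * β := by gcongr
            linarith [show α * -((M : ℝ) / L) = -(M * (α / L)) by ring]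
        _ ≤ 1 - α + α * Real.exp (-(M / L)) := hconv
        _ ≤ 1 - α + 1 * Real.exp (-(M / L)) := by gcongr; linarith
        _ = _ := by ring
    rw [hsum]
    refine (sum_le_sum fun a _ => hterm a).trans (le_of_eq ?_)
    rw [sum_add_distrib, ← sum_mul, hP.2, one_mul]
  -- Some codebook does no worse than the average.
  by_contra hcon
  push Not at hcon
  have hw1 := sum_prod_eq_one hQ.2 M
  have hw0 : ∀ cb : Fin M → B, 0 ≤ ∏ m, Q (cb m) := fun cb => prod_nonneg fun m _ => hQ.1 _
  obtain ⟨cb, -, hcb⟩ : ∃ cb ∈ (univ : Finset (Fin M → B)), 0 < ∏ m, Q (cb m) :=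
    exists_lt_of_sum_lt (by simp [hw1])
  have := sum_lt_sum (s := univ) (f := fun cb : Fin M → B => (∏ m, Q (cb m)) * bound)
    (fun cb _ => mul_le_mul_of_nonneg_left (hcon cb).le (hw0 cb))
    ⟨cb, mem_univ cb, mul_lt_mul_of_pos_left (hcon cb) hcb⟩
  rw [← sum_mul, hw1, one_mul] at this
  exact this.not_ge havg

variable {X : Type*} [Fintype X]

theorem prod_mem_stdSimplex {p : X → ℝ} (hp : p ∈ stdSimplex ℝ X) (n : ℕ) :
    (fun x : Fin n → X => ∏ i, p (x i)) ∈ stdSimplex ℝ (Fin n → X) :=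
  ⟨fun _ => prod_nonneg fun _ _ => hp.1 _, sum_prod_eq_one hp.2 n⟩

theorem prod_channel_mem_stdSimplex {W : X → X → ℝ} (hW : IsChannel W) {n : ℕ} (x : Fin n → X) :
    (fun y : Fin n → X => ∏ i, W (x i) (y i)) ∈ stdSimplex ℝ (Fin n → X) := by
  classical
  refine ⟨fun _ => prod_nonneg fun i _ => (hW (x i)).1 _, ?_⟩
  rw [← Fintype.prod_sum (fun i b => W (x i) b)]
  exact prod_eq_one fun i _ => (hW (x i)).2

theorem eventually_exists_code {p : X → ℝ} (hp : p ∈ stdSimplex ℝ X) {dmax : ℝ} {d : X → X → ℝ}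
    (hd : ∀ x y, d x y ∈ Set.Icc 0 dmax) {W : X → X → ℝ} (hW : IsChannel W) {R : ℝ}
    (hR : mutualInfo (fun x y => p x * W x y) < R) {ε : ℝ} (hε : 0 < ε) :
    ∀ᶠ n : ℕ in atTop, ∃ C : Code X n ⌊(2 : ℝ) ^ ((n : ℝ) * R)⌋₊,
      C.avgDistortion p d ≤ channelDistortion p d W + ε := by
  classical
  obtain ⟨x₀⟩ := nonempty_of_mem_stdSimplex hp
  have hdmax : 0 ≤ dmax := (hd x₀ x₀).1.trans (hd x₀ x₀).2
  have h2 : 0 < Real.log 2 := by positivity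
  have hR0 : 0 < R := (mutualInfo_channel_nonneg hp hW).trans_lt hR
  set I := mutualInfo (fun x y => p x * W x y) * Real.log 2 with hI
  -- Half the rate gap in nats: one half bounds the density deviation, the other is surplus codebook
  -- size.
  set κ := (R * Real.log 2 - I) / 2 with hκdef
  have hκ : 0 < κ := by
    have := mul_lt_mul_of_pos_right hR h2
    simp only [hκdef, hI]
    linarith
  set ℓ : X → X → ℝ := fun x y => Real.log (p x * W x y / (p x * outputLaw p W y)) with hℓ
  have hJ0 : ∀ x y, 0 ≤ p x * W x y := fun x y => mul_nonneg (hp.1 x) ((hW x).1 y)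
  have hJ1 : ∑ x, ∑ y, p x * W x y = 1 := by
    simp_rw [← mul_sum, (hW _).2, mul_one, hp.2]
  set μ := channelDistortion p d W with hμ
  have hμ0 : 0 ≤ μ := sum_nonneg fun x _ => sum_nonneg fun y _ => mul_nonneg (hJ0 x y) (hd x y).1
  obtain ⟨r₁, hr₁0, hr₁1, hr₁⟩ := exists_chernoff_bound hJ0 hJ1 d (c := μ + ε / 2)
    (by change μ < _; linarith)
  obtain ⟨r₂, hr₂0, hr₂1, hr₂⟩ := exists_chernoff_bound hJ0 hJ1 ℓ (c := I + κ) (by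
    have := mutualInfo_channel_mul_log_two (p := p) hW
    rw [← hI] at this
    simp only [hℓ]
    rw [← this]; linarith)
  have hlim : Tendsto (fun n : ℕ => dmax * (r₁ ^ n + r₂ ^ n + Real.exp (-κ) ^ n)) atTop
      (𝓝 (dmax * (0 + 0 + 0))) :=
    (((tendsto_pow_atTop_nhds_zero_of_lt_one hr₁0 hr₁1).add
      (tendsto_pow_atTop_nhds_zero_of_lt_one hr₂0 hr₂1)).add
      (tendsto_pow_atTop_nhds_zero_of_lt_one (Real.exp_pos _).le
        (by rw [← Real.exp_zero]; exact Real.exp_lt_exp.2 (by linarith)))).const_mul dmax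
  filter_upwards [hlim.eventually (gt_mem_nhds (by linarith : dmax * (0 + 0 + 0) < ε / 2)),
    eventually_ne_atTop 0] with n hn hn0
  have hnpos : (0 : ℝ) < n := by positivity
  set M := ⌊(2 : ℝ) ^ ((n : ℝ) * R)⌋₊ with hMdef
  have hM1 : 1 ≤ M := Nat.le_floor (by
    rw [Nat.cast_one]; exact Real.one_le_rpow one_le_two (by positivity))
  -- A good pair has distortion and information density both near their means; the density bound
  -- supplies the change of measure `L = exp (n (I + κ))`.
  obtain ⟨G, hGdef⟩ : ∃ G : (Fin n → X) → (Fin n → X) → Prop, ∀ x y, G x y ↔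
      ¬ (n * (μ + ε / 2) < ∑ i, d (x i) (y i)) ∧ ¬ (n * (I + κ) < ∑ i, ℓ (x i) (y i)) :=
    ⟨_, fun _ _ => Iff.rfl⟩
  have hq : outputLaw p W ∈ stdSimplex ℝ X := ⟨outputLaw_nonneg hp hW, sum_outputLaw hp hW⟩
  have hG : ∀ x y, G x y → (∏ i, p (x i)) * ∏ i, W (x i) (y i) ≤
      Real.exp (n * (I + κ)) * ((∏ i, p (x i)) * ∏ i, outputLaw p W (y i)) := by
    intro x y hxy
    rw [← prod_mul_distrib, ← prod_mul_distrib]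
    have hnn : 0 ≤ ∏ i, p (x i) * outputLaw p W (y i) :=
      prod_nonneg fun i _ => mul_nonneg (hp.1 _) (hq.1 _)
    rcases (prod_nonneg fun i _ => hJ0 (x i) (y i)).eq_or_lt with h | h
    · rw [← h]
      exact mul_nonneg (Real.exp_pos _).le hnn
    · have hpos : ∀ i, 0 < p (x i) * W (x i) (y i) := fun i =>
        (hJ0 _ _).lt_of_ne' fun h0 => h.ne' (prod_eq_zero (mem_univ i) h0)
      have hpos' : ∀ i, 0 < p (x i) * outputLaw p W (y i) := fun i =>
        (mul_nonneg (hp.1 _) (hq.1 _)).lt_of_ne' fun h0 =>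
          (hpos i).ne' (eq_zero_of_marginals_mul_eq_zero hp hW h0)
      calc ∏ i, p (x i) * W (x i) (y i)
          = ∏ i, Real.exp (ℓ (x i) (y i)) * (p (x i) * outputLaw p W (y i)) := by
            refine prod_congr rfl fun i _ => ?_
            rw [hℓ, Real.exp_log (div_pos (hpos i) (hpos' i)), div_mul_cancel₀ _ (hpos' i).ne']
        _ = Real.exp (∑ i, ℓ (x i) (y i)) * ∏ i, p (x i) * outputLaw p W (y i) := by
            rw [prod_mul_distrib, Real.exp_sum]
        _ ≤ _ := by
            gcongr
            exact not_lt.1 ((hGdef x y).1 hxy).2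
  obtain ⟨cb, hcb⟩ := exists_codebook (prod_mem_stdSimplex hp n) (prod_mem_stdSimplex hq n)
    (fun x => prod_channel_mem_stdSimplex hW x) G (Real.exp_pos _) hG M
  have hbad : ∑ x : Fin n → X, (∏ i, p (x i)) * (if ∀ m, ¬ G x (cb m) then 1 else 0) ≤
      r₁ ^ n + r₂ ^ n + Real.exp (-κ) ^ n := by
    refine hcb.trans (add_le_add ?_ ?_)
    · refine le_trans ?_ (add_le_add (hr₁ n) (hr₂ n))
      simp_rw [← sum_add_distrib]
      refine sum_le_sum fun x _ => sum_le_sum fun y _ => ?_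
      rw [← prod_mul_distrib, ← mul_add]
      refine mul_le_mul_of_nonneg_left ?_ (prod_nonneg fun i _ => hJ0 _ _)
      by_cases h1 : n * (μ + ε / 2) < ∑ i, d (x i) (y i) <;>
        by_cases h2 : n * (I + κ) < ∑ i, ℓ (x i) (y i) <;> simp [hGdef, h1, h2]
    · rw [← Real.exp_nat_mul, Real.exp_le_exp]
      have hMlow : Real.exp (n * (R * Real.log 2)) - 1 ≤ M := by
        have := (Nat.lt_floor_add_one ((2 : ℝ) ^ ((n : ℝ) * R))).le
        rw [Real.rpow_def_of_pos two_pos, show Real.log 2 * (n * R) = n * (R * Real.log 2) by ring]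
          at this
        rw [hMdef, Real.rpow_def_of_pos two_pos,
          show Real.log 2 * (n * R) = n * (R * Real.log 2) by ring]
        linarith
      have hI0 : 0 ≤ I := mul_nonneg (mutualInfo_channel_nonneg hp hW) h2.le
      have hE : 1 ≤ Real.exp (n * (I + κ)) := Real.one_le_exp (by positivity)
      have hexp : Real.exp (n * (R * Real.log 2)) =
          Real.exp (n * κ) * Real.exp (n * (I + κ)) := by
        rw [← Real.exp_add]; congr 1; simp only [hκdef]; ring
      have hκe := Real.add_one_le_exp (n * κ)
      -- With `E = exp (n (I + κ)) ≥ 1`, the loss from the floor is absorbed: `M ≥ exp (n κ) E - 1 ≥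
      -- (exp (n κ) - 1) E ≥ n κ E`.
      have : n * κ ≤ M / Real.exp (n * (I + κ)) := by
        rw [le_div_iff₀ (Real.exp_pos _)]
        nlinarith
      linarith
  -- The decoder ignores the past samples. An uncovered block gets message `0`, at a cost of at most
  -- `dmax`.
  let C : Code X n M :=
    { enc := fun x => if h : ∃ m, G x (cb m) then h.choose else ⟨0, hM1⟩
      dec := fun i m _ => cb m i }
  refine ⟨C, ?_⟩
  have hx : ∀ x : Fin n → X, 1 / (n : ℝ) * ∑ i, d (x i) (C.reconstruct x i) ≤
      (μ + ε / 2) + dmax * (if ∀ m, ¬ G x (cb m) then 1 else 0) := by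
    intro x
    rw [one_div, inv_mul_le_iff₀ hnpos]
    by_cases h : ∃ m, G x (cb m)
    · rw [if_neg (by push Not; exact h), mul_zero, add_zero]
      have hrec : ∀ i, C.reconstruct x i = cb h.choose i := by
        intro i
        simp only [Code.reconstruct, C, dif_pos h]
      simp_rw [hrec]
      exact not_lt.1 ((hGdef _ _).1 h.choose_spec).1
    · rw [if_pos (by push Not at h; exact h), mul_one]
      calc _ ≤ ∑ _i : Fin n, dmax := sum_le_sum fun i _ => (hd _ _).2
        _ = n * dmax := by simp
        _ ≤ _ := by gcongr; linarith
  calc C.avgDistortion p d ≤ ∑ x : Fin n → X, (∏ i, p (x i)) *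
        ((μ + ε / 2) + dmax * (if ∀ m, ¬ G x (cb m) then 1 else 0)) :=
        sum_le_sum fun x _ => mul_le_mul_of_nonneg_left (hx x) (prod_nonneg fun i _ => hp.1 _)
    _ = (μ + ε / 2) + dmax *
        ∑ x : Fin n → X, (∏ i, p (x i)) * (if ∀ m, ¬ G x (cb m) then 1 else 0) := by
        simp_rw [mul_add, sum_add_distrib, ← sum_mul, mul_left_comm _ dmax, ← mul_sum]
        rw [← mul_add, sum_prod_eq_one hp.2]; ring
    _ ≤ (μ + ε / 2) + dmax * (r₁ ^ n + r₂ ^ n + Real.exp (-κ) ^ n) := by gcongr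
    _ ≤ _ := by linarith

end RandomCoding

/-! ### Achievability at the mutual information itself -/

section Achievability

variable {X : Type*} [Fintype X]

theorem finite_code (n M : ℕ) : Finite (Code X n M) :=
  Finite.of_injective (fun C : Code X n M => (C.enc, C.dec)) fun C C' h => by
    cases C; cases C'
    simpa using h

/-- There are finitely many codes at each length, so taking an optimal one gives a single sequence
that serves every `ε`. -/
theorem achievable_of_eventually_exists_code {p : X → ℝ} {d : X → X → ℝ} [Nonempty X] {D R : ℝ}
    (hR : 0 ≤ R)
    (h : ∀ ε > 0, ∀ᶠ n : ℕ in atTop, ∃ C : Code X n ⌊(2 : ℝ) ^ ((n : ℝ) * R)⌋₊,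
      C.avgDistortion p d ≤ D + ε) :
    Achievable p d D R := by
  have hex : ∀ n : ℕ, ∃ C : Code X n ⌊(2 : ℝ) ^ ((n : ℝ) * R)⌋₊,
      ∀ C' : Code X n ⌊(2 : ℝ) ^ ((n : ℝ) * R)⌋₊, C.avgDistortion p d ≤ C'.avgDistortion p d := by
    intro n
    have hM : 1 ≤ ⌊(2 : ℝ) ^ ((n : ℝ) * R)⌋₊ := Nat.le_floor (by
      rw [Nat.cast_one]; exact Real.one_le_rpow one_le_two (by positivity))
    have := finite_code (X := X) n ⌊(2 : ℝ) ^ ((n : ℝ) * R)⌋₊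
    have : Nonempty (Code X n ⌊(2 : ℝ) ^ ((n : ℝ) * R)⌋₊) :=
      ⟨⟨fun _ => ⟨0, hM⟩, fun _ _ _ => Classical.arbitrary X⟩⟩
    exact Finite.exists_min _
  choose C hC using hex
  exact ⟨C, fun ε hε => (h ε hε).mono fun n ⟨C', hC'⟩ => (hC n C').trans hC'⟩

/-- If the output of `W` is independent of its input, some constant reconstruction is as good. -/
theorem exists_constant_of_mutualInfo_eq_zero {p : X → ℝ} (hp : p ∈ stdSimplex ℝ X)
    (d : X → X → ℝ) {W : X → X → ℝ} (hW : IsChannel W)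
    (h : mutualInfo (fun x y => p x * W x y) = 0) :
    ∃ y, ∑ x, p x * d x y ≤ channelDistortion p d W := by
  have hD : channelDistortion p d W = ∑ y, outputLaw p W y * ∑ x, p x * d x y := by
    unfold channelDistortion
    rw [sum_comm]
    refine sum_congr rfl fun y _ => ?_
    rw [mul_sum]
    refine sum_congr rfl fun x _ => ?_
    rw [eq_mul_outputLaw_of_mutualInfo_eq_zero hp hW h]; ring
  by_contra hcon
  push Not at hcon
  have hs := sum_outputLaw hp hW
  obtain ⟨y, -, hy⟩ : ∃ y ∈ (univ : Finset X), 0 < outputLaw p W y :=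
    exists_lt_of_sum_lt (by simp [hs])
  have := sum_lt_sum (s := univ) (f := fun y => outputLaw p W y * channelDistortion p d W)
    (fun y _ => mul_le_mul_of_nonneg_left (hcon y).le (outputLaw_nonneg hp hW y))
    ⟨y, mem_univ y, mul_lt_mul_of_pos_left (hcon y) hy⟩
  rw [← sum_mul, hs, one_mul, ← hD] at this
  exact this.false

theorem achievable_mutualInfo {p : X → ℝ} (hp : p ∈ stdSimplex ℝ X) {dmax : ℝ} {d : X → X → ℝ}
    (hd : ∀ x y, d x y ∈ Set.Icc 0 dmax) {D : ℝ} {W : X → X → ℝ}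
    (hW : W ∈ feasibleChannels p d D) :
    Achievable p d D (mutualInfo fun x y => p x * W x y) := by
  have hX := nonempty_of_mem_stdSimplex hp
  obtain ⟨hW, hD⟩ := hW
  have hI0 := mutualInfo_channel_nonneg hp hW
  refine achievable_of_eventually_exists_code hI0 fun ε hε => ?_
  -- At rate zero there is a single message and no information to give up, so the mixing argument
  -- has to be replaced.
  rcases hI0.eq_or_lt with hI | hI
  · obtain ⟨y, hy⟩ := exists_constant_of_mutualInfo_eq_zero hp d hW hI.symm
    filter_upwards [eventually_ne_atTop 0] with n hn
    have hM : 1 ≤ ⌊(2 : ℝ) ^ ((n : ℝ) * mutualInfo fun x y => p x * W x y)⌋₊ := by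
      simp [← hI]
    refine ⟨⟨fun _ => ⟨0, hM⟩, fun _ _ _ => y⟩, ?_⟩
    have hn' : (n : ℝ) ≠ 0 := Nat.cast_ne_zero.2 hn
    unfold Code.avgDistortion Code.reconstruct
    simp_rw [mul_sum, mul_left_comm _ (1 / (n : ℝ))]
    rw [sum_comm]
    simp_rw [← mul_sum, sum_prod_mul_apply hp.2 (fun a => d a y)]
    simp only [sum_const, card_univ, Fintype.card_fin, nsmul_eq_mul]
    rw [← mul_assoc, one_div_mul_cancel hn', one_mul]
    linarith
  -- A small `t > 0` costs at most `ε / 2` in distortion and makes the rate strictly larger than the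
  -- information of the mixture, as random coding requires.
  · have hlim : Tendsto (fun t : ℝ => channelDistortion p d
        (fun x y => (1 - t) * W x y + t * outputLaw p W y)) (𝓝[>] 0)
        (𝓝 (channelDistortion p d W)) := by
      have hc : Continuous fun t : ℝ => channelDistortion p d
          (fun x y => (1 - t) * W x y + t * outputLaw p W y) := by
        unfold channelDistortion; fun_prop
      have := hc.tendsto 0
      simp only [sub_zero, one_mul, zero_mul, add_zero] at this
      exact this.mono_left nhdsWithin_le_nhds
    obtain ⟨t, ht, ht01⟩ := ((hlim.eventually (gt_mem_nhds
      (by linarith : channelDistortion p d W < channelDistortion p d W + ε / 2))).and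
      (Ioo_mem_nhdsGT one_pos)).exists
    obtain ⟨hV, hle⟩ := mutualInfo_mix_le hp hW ⟨ht01.1.le, ht01.2.le⟩
    have hlt : (1 - t) * mutualInfo (fun x y => p x * W x y) <
        mutualInfo (fun x y => p x * W x y) := by
      nlinarith [ht01.1]
    refine (eventually_exists_code hp hd hV (hle.trans_lt hlt) (half_pos hε)).mono
      fun n ⟨C, hC⟩ => ⟨C, hC.trans ?_⟩
    linarith

theorem exists_feasible_mutualInfo_eq_infoRDF {p : X → ℝ} (hp : p ∈ stdSimplex ℝ X)
    {d : X → X → ℝ} {D : ℝ} (h : (feasibleChannels p d D).Nonempty) :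
    ∃ W ∈ feasibleChannels p d D,
      ((mutualInfo (fun x y => p x * W x y) : ℝ) : EReal) = infoRDF p d D := by
  have hK : IsCompact (feasibleChannels p d D) :=
    isCompact_isChannel.inter_right (isClosed_le (continuous_channelDistortion p d)
      continuous_const)
  obtain ⟨W, hW, hmin⟩ := hK.exists_isMinOn h
    ((continuousOn_mutualInfo_channel hp).mono fun W hW => hW.1)
  exact ⟨W, hW, le_antisymm (le_iInf₂ fun V hV => EReal.coe_le_coe_iff.2 (hmin hV))
    (iInf₂_le W hW)⟩

end Achievability

end Feedforward

theorem mainTheorem4 {X : Type*} [Fintype X] (p : X → ℝ) (hp : p ∈ stdSimplex ℝ X)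
    (dmax : ℝ) (d : X → X → ℝ) (hd : ∀ x y, d x y ∈ Set.Icc 0 dmax) (D : ℝ) :
    Feedforward.operRDF p d D = Feedforward.infoRDF p d D ∧
      ((∃ R : ℝ, Feedforward.Achievable p d D R) →
        ∃ R : ℝ, Feedforward.Achievable p d D R ∧ (R : EReal) = Feedforward.operRDF p d D) := by
  have heq : Feedforward.operRDF p d D = Feedforward.infoRDF p d D := by
    refine le_antisymm (le_iInf₂ fun W hW => sInf_le
      ⟨_, Feedforward.achievable_mutualInfo hp hd hW, rfl⟩) (le_sInf ?_)
    rintro _ ⟨R, hR, rfl⟩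
    obtain ⟨W, hW, hI⟩ := Feedforward.exists_channel_of_achievable hp hR
    exact (iInf₂_le W hW).trans (EReal.coe_le_coe_iff.2 hI)
  refine ⟨heq, fun ⟨R, hR⟩ => ?_⟩
  obtain ⟨W, hW, -⟩ := Feedforward.exists_channel_of_achievable hp hR
  obtain ⟨V, hV, hI⟩ := Feedforward.exists_feasible_mutualInfo_eq_infoRDF hp ⟨W, hW⟩
  exact ⟨_, Feedforward.achievable_mutualInfo hp hd hV, hI.trans heq.symm⟩
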